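/- Let $p$ be a prime, let $S$ be a reduced, locally Noetherian $\mathbb{F}_p$-scheme, and let $T \subset S$ be a locally closed subscheme. Let $\overline T$ be the closure of $T$ in $S$. If $T$ is affine over $S$ (that is, the inclusion $T \to S$ is an affine morphism), then $\overline T \setminus T$ is either empty or of pure codimension $1$ in $\overline T$, i.e. every irreducible component of $\overline T \setminus T$ has codimension $1$ in $\overline T$. In particular, purity implies weak purity, where $T$ is called pure in $S$ if $T$ is affine over $S$, and weakly pure in $S$ if every irreducible component of $\overline T \setminus T$ has codimension $1$ in $\overline T$. -/

import Mathlib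

open AlgebraicGeometry TopologicalSpace CategoryTheory

universe u

/-- A closed subset `Z` of a topological space `X` has pure codimension `n` in `X` if every
irreducible component of `Z` has codimension `n` in `X`. The irreducible components of `Z` are the
maximal irreducible closed subsets of `X` contained in `Z`, and the codimension in `X` of an
irreducible closed subset `C` is the supremum of the lengths `m` of chains
`C = C₀ ⊂ C₁ ⊂ ... ⊂ Cₘ` of irreducible closed subsets of `X`. -/
def HasPureCodim {X : Type u} [TopologicalSpace X] (Z : Closeds X) (n : ℕ∞) : Prop :=
  ∀ C : IrreducibleCloseds X,
    Maximal (fun D : IrreducibleCloseds X => (D : Set X) ⊆ (Z : Set X)) C → Order.coheight C = n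

namespace LocallyClosedSubscheme

/-! A locally closed subscheme `T` of `S` is given by an immersion `i : T ⟶ S`. -/

variable {S T : Scheme.{u}} (i : T ⟶ S)

/-- The underlying topological space of the closure of `T` in `S`. -/
abbrev Closure : Type u := ↥(closure (Set.range i))

/-- `T`, as a subset of its closure, is open. -/
theorem isOpen_preimage_range [IsImmersion i] :
    IsOpen ((↑) ⁻¹' Set.range i : Set (Closure i)) :=
  i.isLocallyClosed_range.isOpen_preimage_val_closure

/-- The complement of `T` in its closure, a closed subset of the closure. -/
def boundary [IsImmersion i] : Closeds (Closure i) :=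
  ⟨((↑) ⁻¹' Set.range i)ᶜ, (isOpen_preimage_range i).isClosed_compl⟩

/-- `T` is pure in `S` if `T` is affine over `S`. -/
def IsPure [IsImmersion i] : Prop := IsAffineHom i

/-- `T` is weakly pure in `S` if each irreducible component of the complement of `T` in its
closure has codimension `1` in the closure. -/
def IsWeaklyPure [IsImmersion i] [IsLocallyNoetherian S] : Prop :=
  HasPureCodim (boundary i) 1

end LocallyClosedSubscheme

/-! The codimension is computed at the generic point `ξ` of a component `C` of the boundary. As an
affine morphism is quasi-compact, `ξ` is a specialization of a point of `T`, which is different from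
`ξ`; so the codimension is at least one (`coheight_eq_one_of_maximal`, using
`exists_specializes_of_mem_closure_range`).

Let `A` be the local ring of `S` at `ξ` and `m` its maximal ideal. By maximality of `C`, the proper
generizations of `ξ` in the closure of `T` all lie in `T`, and since `T` is affine over `S`, the
inverse image of `T` in `Spec A` is `Spec B` for a ring `B`. A chain of two proper generizations of
`ξ` gives a prime `q` of `B` over a prime `P` of `A`, and a prime strictly between `P` and `m`, which
`RingHom.SurjectiveOnStalks.comap_eq_of_le` excludes. That is the statement that the punctured
spectrum of a local domain of dimension at least two is not affine. It is usually derived from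
Grothendieck's nonvanishing theorem for local cohomology; the argument here is elementary. With
`B' = B ⧸ q`, the `A`-module `N = B' / im A` is `m`-power torsion and satisfies `m N = N`, and for
`x ∈ m` nonzero in `B'` the kernel of `x` on `N` has finite length. A stabilizing chain then shows
`x N = N` (`exists_smul_eq_of_isArtinian_ker`), hence `B' = im A + x B'`, hence `x` is a unit in
`B'` (`isUnit_algebraMap_of_map_maximalIdeal_eq_top`). So no prime other than `P` containing `P` and
different from `m` is left. -/

/-! ### Torsion modules over a Noetherian local ring -/

open IsLocalRing in
theorem isArtinianRing_quotient_maximalIdeal_pow {A : Type*} [CommRing A] [IsNoetherianRing A]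
    [IsLocalRing A] (k : ℕ) : IsArtinianRing (A ⧸ maximalIdeal A ^ k) := by
  have : Ring.KrullDimLE 0 (A ⧸ maximalIdeal A ^ k) := by
    refine Ring.KrullDimLE.mk₀ fun J hJ ↦ ?_
    have hle : maximalIdeal A ≤ J.comap (Ideal.Quotient.mk _) := by
      refine Ideal.IsPrime.le_of_pow_le (n := k) fun a ha ↦ ?_
      rw [Ideal.mem_comap, Ideal.Quotient.eq_zero_iff_mem.mpr ha]
      exact J.zero_mem
    have hmax : (J.comap (Ideal.Quotient.mk (maximalIdeal A ^ k))).IsMaximal := by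
      rw [← (maximalIdeal.isMaximal A).eq_of_le (Ideal.IsPrime.ne_top inferInstance) hle]
      exact maximalIdeal.isMaximal A
    rw [← Ideal.map_comap_of_surjective _ Ideal.Quotient.mk_surjective J]
    refine (Ideal.map_eq_top_or_isMaximal_of_surjective _ Ideal.Quotient.mk_surjective
      hmax).resolve_left fun h ↦ hJ.ne_top ?_
    rwa [Ideal.map_comap_of_surjective _ Ideal.Quotient.mk_surjective] at h
  exact IsNoetherianRing.isArtinianRing_of_krullDimLE_zero

theorem Submodule.FG.exists_pow_smul_eq_zero {A N : Type*} [CommRing A] [AddCommGroup N]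
    [Module A N] {I : Ideal A} {L : Submodule A N} (hL : L.FG)
    (h : ∀ n ∈ L, ∃ k, ∀ a ∈ I ^ k, a • n = 0) : ∃ k, ∀ a ∈ I ^ k, ∀ n ∈ L, a • n = 0 := by
  obtain ⟨s, rfl⟩ := hL
  choose! e he using h
  refine ⟨s.sup e, fun a ha n hn ↦ ?_⟩
  induction hn using Submodule.span_induction with
  | mem n hn =>
    exact he n (Submodule.subset_span hn) a (Ideal.pow_le_pow_right (Finset.le_sup hn) ha)
  | zero => simp
  | add n n' _ _ h h' => rw [smul_add, h, h', add_zero]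
  | smul c n _ h => rw [smul_comm, h, smul_zero]

open IsLocalRing in
theorem isArtinian_of_maximalIdeal_pow_smul_eq_zero {A N : Type*} [CommRing A] [IsNoetherianRing A]
    [IsLocalRing A] [AddCommGroup N] [Module A N] [Module.Finite A N] {k : ℕ}
    (h : ∀ a ∈ maximalIdeal A ^ k, ∀ n : N, a • n = 0) : IsArtinian A N := by
  have htors : Module.IsTorsionBySet A N (maximalIdeal A ^ k : Ideal A) := fun n a ↦ h a a.2 n
  let _ := htors.module
  have := isArtinianRing_quotient_maximalIdeal_pow (A := A) k
  have : Module.Finite (A ⧸ maximalIdeal A ^ k) N := Module.Finite.of_restrictScalars_finite A _ _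
  have : IsArtinian (A ⧸ maximalIdeal A ^ k) N := inferInstance
  let l : N →ₛₗ[Ideal.Quotient.mk (maximalIdeal A ^ k)] N :=
    { toFun := id, map_add' := fun _ _ ↦ rfl, map_smul' := fun _ _ ↦ rfl }
  exact (l.isArtinian_iff_of_bijective Function.bijective_id).mpr this

/-- If the kernel of an element `x` on an `x`-power torsion module `N` is Artinian and killed by a
power of an ideal `I` with `I N = N`, then `x` acts surjectively on `N`.

The chain `xᵉ N ∩ ker x` stabilizes, which gives `N = x N + ker xᵉ` for large `e`. As `ker xᵉ` is
killed by a power of `I`, it follows that `N = Iʲ N ⊆ x N` for large `j`. -/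
theorem exists_smul_eq_of_isArtinian_ker {A N : Type*} [CommRing A] [AddCommGroup N]
    [Module A N] {I : Ideal A} {x : A} {k : ℕ} [IsArtinian A (LinearMap.ker (LinearMap.lsmul A N x))]
    (hx : ∀ n : N, ∃ e, x ^ e • n = 0) (hk : ∀ a ∈ I ^ k, ∀ n : N, x • n = 0 → a • n = 0)
    (hI : I • (⊤ : Submodule A N) = ⊤) (n : N) : ∃ n', x • n' = n := by
  -- The decreasing chain `xᵉ N ∩ ker x`.
  let K : ℕ →o (Submodule A (LinearMap.ker (LinearMap.lsmul A N x)))ᵒᵈ :=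
    { toFun := fun e ↦ OrderDual.toDual
        ((LinearMap.range (LinearMap.lsmul A N (x ^ e))).comap (Submodule.subtype _))
      monotone' := by
        intro e e' hee z hz
        obtain ⟨v, hv⟩ := hz
        refine ⟨x ^ (e' - e) • v, ?_⟩
        rw [← hv]
        simp only [LinearMap.lsmul_apply, smul_smul, ← pow_add]
        rw [Nat.add_sub_cancel' hee] }
  obtain ⟨e₀, he₀⟩ := IsArtinian.monotone_stabilizes K
  have key (e : ℕ) : ∀ w : N, x ^ e • x ^ e₀ • w = 0 → ∃ v, x ^ e₀ • w = x ^ e₀ • x • v := by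
    induction e with
    | zero => exact fun w hw ↦ ⟨0, by simpa using hw⟩
    | succ e ih =>
      intro w hw
      have hmem : (⟨x ^ e • x ^ e₀ • w, by
          rwa [LinearMap.mem_ker, LinearMap.lsmul_apply, smul_smul, ← pow_succ']⟩ :
            LinearMap.ker (LinearMap.lsmul A N x)) ∈ OrderDual.ofDual (K e₀) :=
        ⟨x ^ e • w, by simp [smul_smul, mul_comm]⟩
      rw [he₀ (e₀ + e + 1) (by omega)] at hmem
      obtain ⟨v, hv⟩ := hmem
      replace hv : x ^ (e₀ + e + 1) • v = x ^ e • x ^ e₀ • w := hv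
      obtain ⟨v', hv'⟩ := ih (w - x • v) (by
        rw [smul_sub, smul_sub, ← hv, sub_eq_zero]
        simp only [smul_smul]
        congr 1
        ring)
      refine ⟨v + v', ?_⟩
      rw [smul_add, smul_add, ← hv', smul_sub]
      abel
  -- `N = x N + ker x ^ e₀`, and `ker x ^ j` is killed by `I ^ (k * j)`.
  have decomp (n : N) : ∃ v u, n = x • v + u ∧ x ^ e₀ • u = 0 := by
    obtain ⟨e, he⟩ := hx n
    obtain ⟨v, hv⟩ := key e n (by rw [smul_comm, he, smul_zero])
    exact ⟨v, n - x • v, by abel, by rw [smul_sub, hv, sub_self]⟩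
  have kill (j : ℕ) : ∀ a ∈ I ^ (k * j), ∀ u : N, x ^ j • u = 0 → a • u = 0 := by
    induction j with
    | zero => exact fun a _ u hu ↦ by rw [show u = 0 by simpa using hu, smul_zero]
    | succ j ih =>
      intro a ha u hu
      rw [Nat.mul_succ, pow_add] at ha
      induction ha using Submodule.mul_induction_on' with
      | mem_mul_mem b hb c hc =>
        rw [mul_smul]
        refine ih b hb _ ?_
        rw [smul_comm]
        exact hk c hc _ (by rwa [smul_smul, ← pow_succ'])
      | add b _ c _ hb hc => rw [add_smul, hb, hc, add_zero]
  have hpow (j : ℕ) : I ^ j • (⊤ : Submodule A N) = ⊤ := by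
    induction j with
    | zero => simp
    | succ j ih => rw [pow_succ, Submodule.mul_smul, hI, ih]
  have hn : n ∈ I ^ (k * e₀) • (⊤ : Submodule A N) := by
    rw [hpow]; exact Submodule.mem_top
  induction hn using Submodule.smul_induction_on' with
  | smul a ha n _ =>
    obtain ⟨v, u, rfl, hu⟩ := decomp n
    exact ⟨a • v, by rw [smul_add, kill e₀ a ha u hu, add_zero, smul_comm]⟩
  | add n _ n' _ h h' =>
    obtain ⟨v, rfl⟩ := h
    obtain ⟨v', rfl⟩ := h'
    exact ⟨v + v', smul_add _ _ _⟩

/-! ### Affineness of the punctured spectrum -/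

open IsLocalRing in
/-- Suppose that the maximal ideal `m` of a Noetherian local ring `A` generates the unit ideal of a
domain `B` over `A`, and that the cokernel of `A → B` is `m`-power torsion. Then every element of
`m` that is nonzero in `B` is a unit in `B`.

Multiplication by `x ∈ m` on the cokernel has finite length kernel, so it is surjective; that is,
`B = A + x B`. Hence `1 ∈ m B ⊆ m + x B`, and elements of `1 + m` are units. -/
theorem isUnit_algebraMap_of_map_maximalIdeal_eq_top {A B : Type*} [CommRing A]
    [IsNoetherianRing A] [IsLocalRing A] [CommRing B] [IsDomain B] [Algebra A B]
    (htop : (maximalIdeal A).map (algebraMap A B) = ⊤)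
    (htors : ∀ b : B, ∃ k, ∀ a ∈ maximalIdeal A ^ k,
      a • b ∈ LinearMap.range (Algebra.linearMap A B))
    {x : A} (hx : x ∈ maximalIdeal A) (hx₀ : algebraMap A B x ≠ 0) :
    IsUnit (algebraMap A B x) := by
  set R := LinearMap.range (Algebra.linearMap A B) with hR
  let f := LinearMap.lsmul A B x
  have hinj : Function.Injective f := fun b b' h ↦ by
    simpa [f, Algebra.smul_def, hx₀] using h
  -- The kernel of `x` on `B ⧸ R` is `{b | x b ∈ R} / R`, and `{b | x b ∈ R}` is isomorphic to a
  -- submodule of the Noetherian module `R`.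
  have hNoeth : IsNoetherian A (R.comap f) :=
    isNoetherian_of_injective (f.restrict (p := R.comap f) (q := R) fun _ h ↦ h)
      fun b b' h ↦ Subtype.ext (hinj congr(($h).1))
  have hker : LinearMap.ker (LinearMap.lsmul A (B ⧸ R) x) = (R.comap f).map R.mkQ := by
    ext n
    obtain ⟨b, rfl⟩ := R.mkQ_surjective n
    constructor
    · intro h
      refine ⟨b, ?_, rfl⟩
      rw [LinearMap.mem_ker, LinearMap.lsmul_apply, ← map_smul] at h
      exact (Submodule.Quotient.mk_eq_zero R).mp h
    · rintro ⟨c, hc, hcb⟩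
      rw [← hcb, LinearMap.mem_ker, LinearMap.lsmul_apply, ← map_smul]
      exact (Submodule.Quotient.mk_eq_zero R).mpr hc
  have hfg : (LinearMap.ker (LinearMap.lsmul A (B ⧸ R) x)).FG := by
    rw [hker]
    exact ((Submodule.fg_top _).mp ((isNoetherian_def).mp hNoeth ⊤)).map _
  have htors' (n : B ⧸ R) : ∃ k, ∀ a ∈ maximalIdeal A ^ k, a • n = 0 := by
    obtain ⟨b, rfl⟩ := R.mkQ_surjective n
    obtain ⟨k, hk⟩ := htors b
    refine ⟨k, fun a ha ↦ ?_⟩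
    rw [← map_smul]
    exact (Submodule.Quotient.mk_eq_zero R).mpr (hk a ha)
  obtain ⟨k, hk⟩ := hfg.exists_pow_smul_eq_zero fun n _ ↦ htors' n
  have : Module.Finite A (LinearMap.ker (LinearMap.lsmul A (B ⧸ R) x)) := Module.Finite.iff_fg.mpr hfg
  have := isArtinian_of_maximalIdeal_pow_smul_eq_zero
    (N := LinearMap.ker (LinearMap.lsmul A (B ⧸ R) x)) fun a ha n ↦ Subtype.ext (hk a ha n n.2)
  have hI : maximalIdeal A • (⊤ : Submodule A (B ⧸ R)) = ⊤ := by
    have : maximalIdeal A • (⊤ : Submodule A B) = ⊤ := by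
      rw [Ideal.smul_top_eq_map, htop]; rfl
    rw [← R.range_mkQ, ← Submodule.map_top, ← Submodule.map_smul'', this]
  have hsurj := exists_smul_eq_of_isArtinian_ker (x := x)
    (fun n ↦ (htors' n).imp fun k hk ↦ hk _ (Ideal.pow_mem_pow hx k)) (fun a ha n hn ↦ hk a ha n hn) hI
  have hdec (b : B) : ∃ a c, b = algebraMap A B a + algebraMap A B x * c := by
    obtain ⟨n, hn⟩ := hsurj (R.mkQ b)
    obtain ⟨c, rfl⟩ := R.mkQ_surjective n
    rw [← map_smul] at hn
    obtain ⟨a, ha⟩ := (Submodule.Quotient.eq R).mp hn.symm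
    refine ⟨a, c, ?_⟩
    rw [Algebra.linearMap_apply, Algebra.smul_def] at ha
    rw [ha]; ring
  have hone : ∀ b ∈ (maximalIdeal A).map (algebraMap A B), ∃ a ∈ maximalIdeal A, ∃ c,
      b = algebraMap A B a + algebraMap A B x * c := by
    intro b hb
    induction hb using Submodule.span_induction with
    | mem b hb =>
      obtain ⟨a, ha, rfl⟩ := hb
      exact ⟨a, ha, 0, by simp⟩
    | zero => exact ⟨0, zero_mem _, 0, by simp⟩
    | add b b' _ _ h h' =>
      obtain ⟨a, ha, c, rfl⟩ := h
      obtain ⟨a', ha', c', rfl⟩ := h'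
      exact ⟨a + a', add_mem ha ha', c + c', by rw [map_add]; ring⟩
    | smul d b _ h =>
      obtain ⟨a, ha, c, rfl⟩ := h
      obtain ⟨a', c', rfl⟩ := hdec d
      refine ⟨a' * a, Ideal.mul_mem_left _ _ ha,
        (algebraMap A B a' + algebraMap A B x * c') * c + c' * algebraMap A B a, ?_⟩
      rw [smul_eq_mul, map_mul]; ring
  obtain ⟨a, ha, c, hc⟩ := hone 1 (htop ▸ Submodule.mem_top)
  have hunit : IsUnit (algebraMap A B (1 - a)) :=
    (isUnit_one_sub_self_of_mem_nonunits a ha).map _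
  refine isUnit_of_mul_isUnit_left (y := c) ?_
  rwa [show algebraMap A B x * c = algebraMap A B (1 - a) by rw [map_sub, map_one, hc]; ring]

open IsLocalRing in
/-- The punctured spectrum of a Noetherian local domain is affine only in dimension at most one,
stated for the closure of a point: if `Spec B → Spec A` is an immersion which misses the closed
point `m` and whose image contains all specializations of the image `P` of `q` other than `m`, then
there is no prime strictly between `P` and `m`. -/
theorem RingHom.SurjectiveOnStalks.comap_eq_of_le {A B : Type*} [CommRing A]
    [IsNoetherianRing A] [IsLocalRing A] [CommRing B] {φ : A →+* B} (hφ : φ.SurjectiveOnStalks)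
    (hemb : Topology.IsInducing (PrimeSpectrum.comap φ)) {q : PrimeSpectrum B}
    (hm : closedPoint A ∉ Set.range (PrimeSpectrum.comap φ))
    (hrange : ∀ Q : PrimeSpectrum A, PrimeSpectrum.comap φ q ≤ Q → Q ≠ closedPoint A →
      Q ∈ Set.range (PrimeSpectrum.comap φ))
    {Q : PrimeSpectrum A} (hQ : PrimeSpectrum.comap φ q ≤ Q) (hQm : Q ≠ closedPoint A) :
    PrimeSpectrum.comap φ q = Q := by
  let _ : Algebra A (B ⧸ q.asIdeal) := ((Ideal.Quotient.mk q.asIdeal).comp φ).toAlgebra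
  have hmap (a : A) : algebraMap A (B ⧸ q.asIdeal) a = Ideal.Quotient.mk q.asIdeal (φ a) := rfl
  -- A maximal ideal of `B` containing `m B` would lie over `m`.
  have htop : (maximalIdeal A).map φ = ⊤ := by
    by_contra hne
    obtain ⟨M, hM, hle⟩ := Ideal.exists_le_maximal _ hne
    refine hm ⟨⟨M, hM.isPrime⟩, PrimeSpectrum.ext ?_⟩
    exact ((maximalIdeal.isMaximal A).eq_of_le (Ideal.IsPrime.ne_top inferInstance)
      (Ideal.map_le_iff_le_comap.mp hle)).symm
  have htors (b : B ⧸ q.asIdeal) : ∃ k, ∀ a ∈ maximalIdeal A ^ k,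
      a • b ∈ LinearMap.range (Algebra.linearMap A (B ⧸ q.asIdeal)) := by
    -- Every prime containing the ideal `J` of denominators of `b` contains `m`: at any other prime
    -- over `P` the map `A → B` is surjective on stalks, which provides a denominator outside it.
    let J : Ideal A := (LinearMap.range (Algebra.linearMap A (B ⧸ q.asIdeal))).comap
      (LinearMap.toSpanSingleton A _ b)
    suffices h : maximalIdeal A ≤ J.radical from
      Ideal.exists_pow_le_of_le_radical_of_fg h (IsNoetherian.noetherian _)
    rw [Ideal.radical_eq_sInf]
    refine le_sInf fun P ⟨hJP, hP⟩ ↦ ?_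
    by_contra hmP
    have hqP : PrimeSpectrum.comap φ q ≤ ⟨P, hP⟩ := by
      intro a ha
      refine hJP ⟨0, ?_⟩
      have : algebraMap A (B ⧸ q.asIdeal) a = 0 := Ideal.Quotient.eq_zero_iff_mem.mpr ha
      simp [Algebra.smul_def, this]
    obtain ⟨t, ht⟩ := hrange ⟨P, hP⟩ hqP fun h ↦ hmP (congr_arg PrimeSpectrum.asIdeal h).ge
    have hqt : q ≤ t := by
      rw [PrimeSpectrum.le_iff_specializes, ← hemb.specializes_iff,
        ← PrimeSpectrum.le_iff_specializes, ht]
      exact hqP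
    obtain ⟨b, rfl⟩ := Ideal.Quotient.mk_surjective b
    obtain ⟨r, s, c, hc, hs, e⟩ := RingHom.surjectiveOnStalks_iff_forall_ideal.mp hφ t.asIdeal
      t.2.ne_top b
    have hsJ : s ∈ J := by
      refine ⟨r, ?_⟩
      have hc' : Ideal.Quotient.mk q.asIdeal c ≠ 0 := fun h ↦
        hc (hqt (Ideal.Quotient.eq_zero_iff_mem.mp h))
      refine mul_left_cancel₀ hc' ?_
      simp only [Algebra.linearMap_apply, LinearMap.toSpanSingleton_apply, Algebra.smul_def, hmap,
        ← map_mul, ← e, mul_assoc]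
    have : s ∈ (PrimeSpectrum.comap φ t).asIdeal := by rw [ht]; exact hJP hsJ
    exact hs this
  have htop' : (maximalIdeal A).map (algebraMap A (B ⧸ q.asIdeal)) = ⊤ := by
    rw [show algebraMap A (B ⧸ q.asIdeal) = (Ideal.Quotient.mk q.asIdeal).comp φ from rfl,
      ← Ideal.map_map, htop, Ideal.map_top]
  refine le_antisymm hQ fun x hxQ ↦ ?_
  by_contra hxq
  have hxm : x ∈ maximalIdeal A := le_maximalIdeal Q.2.ne_top hxQ
  -- An element `x` of `Q` outside `P` is invertible in `B ⧸ q`; clearing denominators of its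
  -- inverse by powers of `m` puts a power of `m` into `Q`.
  obtain ⟨b, hb⟩ := (isUnit_algebraMap_of_map_maximalIdeal_eq_top htop' htors hxm
    fun h ↦ hxq ((Ideal.Quotient.eq_zero_iff_mem (I := q.asIdeal)).mp h)).exists_right_inv
  obtain ⟨k, hk⟩ := htors b
  have hle : maximalIdeal A ^ k ≤ Q.asIdeal := by
    intro f hf
    obtain ⟨a, ha⟩ := hk f hf
    have h0 : f - x * a ∈ (PrimeSpectrum.comap φ q).asIdeal := by
      refine (Ideal.Quotient.eq_zero_iff_mem (I := q.asIdeal)).mp (?_ : algebraMap A (B ⧸ q.asIdeal) _ = 0)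
      rw [Algebra.linearMap_apply, Algebra.smul_def] at ha
      rw [map_sub, map_mul, ha]
      linear_combination -(algebraMap A (B ⧸ q.asIdeal) f) * hb
    have := Q.asIdeal.add_mem (hQ h0) (Q.asIdeal.mul_mem_right a hxQ)
    rwa [sub_add_cancel] at this
  exact hQm (PrimeSpectrum.ext ((maximalIdeal.isMaximal A).eq_of_le Q.2.ne_top
    (Ideal.IsPrime.le_of_pow_le hle)).symm)

/-! ### Affine immersions near a point -/

/-- Base change of an affine immersion to an affine scheme `Spec R`: it becomes `Spec` of a ring
homomorphism, whose image is the inverse image of that of `i`. Applied to `Spec` of a local ring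
and to an affine open subscheme. -/
theorem AlgebraicGeometry.IsAffineHom.exists_mem_range_comap_iff {S T : Scheme.{u}}
    (i : T ⟶ S) [IsPreimmersion i] [IsAffineHom i] {R : CommRingCat.{u}} (j : Spec R ⟶ S) :
    ∃ (B : CommRingCat.{u}) (φ : R ⟶ B), IsPreimmersion (Spec.map φ) ∧
      ∀ P : PrimeSpectrum R, P ∈ Set.range (PrimeSpectrum.comap φ.hom) ↔ j P ∈ Set.range i := by
  let g := (Limits.pullback j i).isoSpec.inv ≫ Limits.pullback.fst j i
  have hg : Spec.map (Spec.preimage g) = g := Spec.map_preimage g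
  have hrange : Set.range g = j ⁻¹' Set.range i := by
    rw [← Scheme.Pullback.range_fst, Scheme.Hom.comp_base, TopCat.coe_comp, Set.range_comp,
      Set.range_eq_univ.mpr (Limits.pullback j i).isoSpec.inv.surjective, Set.image_univ]
  refine ⟨_, Spec.preimage g, ?_, fun P ↦ ?_⟩
  · rw [hg]; infer_instance
  · change P ∈ Set.range (Spec.map (Spec.preimage g)) ↔ P ∈ j ⁻¹' Set.range i
    rw [hg, hrange]

/-- Affine morphisms are quasi-compact, so the closure of the image is already obtained by adding
the specializations of its points. -/
theorem AlgebraicGeometry.IsAffineHom.exists_specializes_of_mem_closure_range {S T : Scheme.{u}}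
    (i : T ⟶ S) [IsPreimmersion i] [IsAffineHom i] {x : S} (hx : x ∈ closure (Set.range i)) :
    ∃ t ∈ Set.range i, t ⤳ x := by
  obtain ⟨W, hW, hxW, -⟩ := exists_isAffineOpen_mem_and_subset (U := ⊤) (x := x) (by simp)
  obtain ⟨B, φ, -, hφ⟩ := exists_mem_range_comap_iff i hW.fromSpec
  obtain ⟨P, rfl⟩ : x ∈ Set.range hW.fromSpec := by rwa [hW.range_fromSpec]
  have hP : P ∈ closure (hW.fromSpec ⁻¹' Set.range i) := by
    rw [← hW.fromSpec.isOpenEmbedding.isOpenMap.preimage_closure_eq_closure_preimage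
      hW.fromSpec.continuous]
    exact hx
  have hP' : P ∈ PrimeSpectrum.zeroLocus (RingHom.ker φ.hom : Set Γ(S, W)) := by
    rw [← PrimeSpectrum.closure_range_comap]
    exact closure_mono (fun Q hQ ↦ (hφ Q).mpr hQ) hP
  have := P.2
  obtain ⟨q, -, hq, hqP⟩ := P.asIdeal.exists_ideal_comap_le_prime (f := φ.hom) ⊥ hP'
  refine ⟨_, (hφ _).mp ⟨⟨q, hq⟩, rfl⟩, ?_⟩
  exact ((PrimeSpectrum.le_iff_specializes _ _).mp hqP).map hW.fromSpec.continuous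

/-! ### Codimension of the boundary -/

namespace LocallyClosedSubscheme

theorem coheight_eq_one_of_maximal {S T : Scheme.{u}} [IsLocallyNoetherian S] (i : T ⟶ S)
    [IsImmersion i] [IsAffineHom i] {C : IrreducibleCloseds (Closure i)}
    (hC : Maximal (fun D : IrreducibleCloseds (Closure i) ↦
      (D : Set (Closure i)) ⊆ (boundary i : Set (Closure i))) C) : Order.coheight C = 1 := by
  have : QuasiSober (Closure i) := isClosed_closure.isClosedEmbedding_subtypeVal.quasiSober
  let pt (y : Closure i) : IrreducibleCloseds (Closure i) :=
    ⟨closure {y}, isIrreducible_singleton.closure, isClosed_closure⟩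
  have hle {y : Closure i} {D : IrreducibleCloseds (Closure i)} {η : Closure i}
      (hη : IsGenericPoint η (D : Set (Closure i))) (h : y ⤳ η) : D ≤ pt y := by
    intro z hz
    exact specializes_iff_mem_closure.mp (h.trans (hη.specializes hz))
  have gen (D : IrreducibleCloseds (Closure i)) : ∃ η, IsGenericPoint η (D : Set (Closure i)) :=
    ⟨_, D.isIrreducible.isGenericPoint_genericPoint D.isClosed⟩
  obtain ⟨ξ, hξ⟩ := gen C
  have hξT : ξ.1 ∉ Set.range i := hC.prop hξ.mem
  -- By maximality of `C`, every proper generization of `ξ` lies in `T`.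
  have hT (y : Closure i) (h : y ⤳ ξ) (hne : y ≠ ξ) : y.1 ∈ Set.range i := by
    by_contra hy
    have hyC : pt y ≤ C := hC.le_of_ge
      ((boundary i).isClosed.closure_subset_iff.mpr (Set.singleton_subset_iff.mpr hy)) (hle hξ h)
    exact hne (h.antisymm (hξ.specializes (hyC (subset_closure rfl)))).eq
  -- Codimension at most one: given `C ⊂ D₁ ⊆ D₂`, pass to the local ring of `S` at `ξ` and compare
  -- the primes of the generic points of `D₁` and `D₂`. Codimension at least one: `ξ` is a
  -- specialization of a point of `T`.
  refine le_antisymm ?_ ?_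
  · refine Order.coheight_le_coe_iff (n := 1).mpr fun D₁ hD₁ ↦ ?_
    suffices IsMax D₁ by
      rw [Order.coheight_eq_zero.mpr this]; exact zero_lt_one
    intro D₂ hD₂
    obtain ⟨η₁, hη₁⟩ := gen D₁
    obtain ⟨η₂, hη₂⟩ := gen D₂
    have h₁ : η₁ ⤳ ξ := hη₁.specializes (hD₁.le hξ.mem)
    have h₂₁ : η₂ ⤳ η₁ := hη₂.specializes (hD₂ hη₁.mem)
    have hne₁ : η₁ ≠ ξ := by
      rintro rfl
      exact hD₁.ne (IrreducibleCloseds.ext (hξ.def.symm.trans hη₁.def))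
    have hne₂ : η₂ ≠ ξ := by
      rintro rfl
      exact hne₁ (h₁.antisymm h₂₁).eq
    obtain ⟨B, φ, himm, hφ⟩ :=
      IsAffineHom.exists_mem_range_comap_iff i (S.fromSpecStalk ξ.1)
    rw [IsPreimmersion.SpecMap_iff] at himm
    have hemb := (S.fromSpecStalk ξ.1).isEmbedding
    have lift (y : Closure i) (h : y ⤳ ξ) : ∃ Q, S.fromSpecStalk ξ.1 Q = y.1 := by
      have : y.1 ∈ Set.range (S.fromSpecStalk ξ.1) := by
        rw [Scheme.range_fromSpecStalk]
        exact h.map continuous_subtype_val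
      exact this
    obtain ⟨Q₁, hQ₁⟩ := lift η₁ h₁
    obtain ⟨Q₂, hQ₂⟩ := lift η₂ (h₂₁.trans h₁)
    obtain ⟨q, hq⟩ : Q₂ ∈ Set.range (PrimeSpectrum.comap φ.hom) := by
      refine (hφ _).mpr ?_
      rw [hQ₂]
      exact hT η₂ (h₂₁.trans h₁) hne₂
    have hclosed : IsLocalRing.closedPoint (S.presheaf.stalk ξ.1) ∉
        Set.range (PrimeSpectrum.comap φ.hom) := by
      rw [hφ, Scheme.fromSpecStalk_closedPoint]
      exact hξT
    have hrange (Q : PrimeSpectrum (S.presheaf.stalk ξ.1)) (hQ : PrimeSpectrum.comap φ.hom q ≤ Q)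
        (hQm : Q ≠ IsLocalRing.closedPoint _) : Q ∈ Set.range (PrimeSpectrum.comap φ.hom) := by
      rw [hφ]
      have hsp : η₂.1 ⤳ S.fromSpecStalk ξ.1 Q := by
        rw [← hQ₂, ← hq]
        exact ((PrimeSpectrum.le_iff_specializes _ _).mp hQ).map hemb.continuous
      have hspx : S.fromSpecStalk ξ.1 Q ⤳ ξ.1 := by
        have : S.fromSpecStalk ξ.1 Q ∈ Set.range (S.fromSpecStalk ξ.1) := ⟨Q, rfl⟩
        rwa [Scheme.range_fromSpecStalk] at this
      refine hT ⟨_, hsp.mem_closed isClosed_closure η₂.2⟩ (Topology.IsInducing.subtypeVal.specializes_iff.mp hspx) ?_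
      intro h
      refine hQm (hemb.injective ?_)
      rw [Scheme.fromSpecStalk_closedPoint]
      exact congr_arg Subtype.val h
    have hQ₂₁ : PrimeSpectrum.comap φ.hom q ≤ Q₁ := by
      rw [hq]
      refine (PrimeSpectrum.le_iff_specializes _ _).mpr (hemb.isInducing.specializes_iff.mp ?_)
      rw [hQ₁, hQ₂]
      exact h₂₁.map continuous_subtype_val
    have heq := himm.2.comap_eq_of_le himm.1.isInducing hclosed hrange hQ₂₁ (by
      rintro rfl
      rw [Scheme.fromSpecStalk_closedPoint] at hQ₁
      exact hne₁ (Subtype.ext hQ₁.symm))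
    rw [hq] at heq
    have hη : η₂ = η₁ := Subtype.ext (by rw [← hQ₁, ← hQ₂, heq])
    exact (IrreducibleCloseds.ext (hη₂.def.symm.trans (hη ▸ hη₁.def)) : D₂ = D₁).le
  · rw [Order.one_le_iff_pos, Order.coheight_pos]
    intro hmax
    obtain ⟨t, ht, htξ⟩ := IsAffineHom.exists_specializes_of_mem_closure_range i ξ.2
    let t' : Closure i := ⟨t, subset_closure ht⟩
    have h : C ≤ pt t' := hle hξ (Topology.IsInducing.subtypeVal.specializes_iff.mp htξ)
    exact hC.prop (hmax h (subset_closure rfl : t' ∈ closure {t'})) ht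

end LocallyClosedSubscheme

theorem lemma1 (p : ℕ) [Fact p.Prime] (S : Scheme.{u})
    [S.Over (Spec (CommRingCat.of (ULift.{u} (ZMod p))))]
    [IsReduced S] [IsLocallyNoetherian S]
    {T : Scheme.{u}} (i : T ⟶ S) [IsImmersion i] :
    (IsAffineHom i →
      LocallyClosedSubscheme.boundary i = ⊥ ∨
        HasPureCodim (LocallyClosedSubscheme.boundary i) 1) ∧
    (LocallyClosedSubscheme.IsPure i → LocallyClosedSubscheme.IsWeaklyPure i) :=
  ⟨fun _ ↦ .inr fun _ hC ↦ LocallyClosedSubscheme.coheight_eq_one_of_maximal i hC,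
    fun (_ : IsAffineHom i) _ hC ↦ LocallyClosedSubscheme.coheight_eq_one_of_maximal i hC⟩
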